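/- Let $\mathcal A=\prod_p\mathbb F_p/\bigoplus_p\mathbb F_p$ and $\mathcal B=\prod_p\mathbb F_p[T]/\bigoplus_p\mathbb F_p[T]$, where $p$ runs over all primes; both are $\mathbb Q$-algebras, and $\mathcal A\to\mathcal B$ is the natural map. An index is a finite, possibly empty, sequence $\mathbf k=(k_1,\dots,k_r)$ of positive integers; its weight is $\mathrm{wt}(\mathbf k)=k_1+\cdots+k_r$. For an index $\mathbf k$ define the finite multiple polylogarithm and the finite multiple zeta value $$\mathrm{li}_{\mathbf k}(T)=\Bigl(\sum_{0<l_1,\dots,l_r<p}{}^{\!\!\!\!\!\prime}\ \frac{T^{l_1+\cdots+l_r}}{l_1^{k_1}(l_1+l_2)^{k_2}\cdots(l_1+\cdots+l_r)^{k_r}}\Bigr)_p\in\mathcal B,\qquad \zeta_{\mathcal A}(\mathbf k)=\Bigl(\sum_{\substack{l_1,\dots,l_r\ge1\\ l_1+\cdots+l_r<p}}\frac{1}{l_1^{k_1}(l_1+l_2)^{k_2}\cdots(l_1+\cdots+l_r)^{k_r}}\Bigr)_p\in\mathcal A,$$ where $\sum'$ means that only the terms whose denominator is prime to $p$ are summed;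 for the empty index both are $1$. Let $T^p\in\mathcal B$ be the element with $p$-component $T^p$. For integers $a\ge0$ and $b$, let $$\mathcal R_{a,b}=\bigl\langle \zeta_{\mathcal A}(\mathbf l)\,(T^p)^n\,\mathrm{li}_{\mathbf l'}(T)\ \bigm|\ n\ge0,\ \mathrm{wt}(\mathbf l)+\mathrm{wt}(\mathbf l')=a,\ \mathrm{wt}(\mathbf l')\le b\bigr\rangle_{\mathbb Q}\subset\mathcal B$$ (so $\mathcal R_{0,-1}=0$). Let ш be the shuffle product on $\mathbb Q\langle x,y\rangle$, i.e. the $\mathbb Q$-bilinear product with $w$ ш $1=1$ ш $w=w$ and $(u_1w_1)$ ш $(u_2w_2)=u_1(w_1$ ш $u_2w_2)+u_2(u_1w_1$ ш $w_2)$ for letters $u_1,u_2\in\{x,y\}$ and words $w_1,w_2$. Put $z_k=x^{k-1}y$ and, for an index $\mathbf k=(k_1,\dots,k_r)$, let $z_{\mathbf k}=z_{k_r}z_{k_{r-1}}\cdots z_{k_1}$. The shuffle product $\mathbf k$ ш $\mathbf k'$ of two indices is the formal linear combination $\sum_{\mathbf l}c_{\mathbf l}\,\mathbf l$ of indices such that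 $z_{\mathbf k}$ ш $z_{\mathbf k'}=\sum_{\mathbf l}c_{\mathbf l}\,z_{\mathbf l}$; for instance $(2)$ ш $(3)=(3,2)+3(2,3)+6(1,4)$. Put $\mathrm{li}_{\mathbf k ш \mathbf k'}(T)=\sum_{\mathbf l}c_{\mathbf l}\,\mathrm{li}_{\mathbf l}(T)$. Theorem. For all indices $\mathbf k$ and $\mathbf k'$, of weights $k$ and $k'$, $$\mathrm{li}_{\mathbf k}(T)\,\mathrm{li}_{\mathbf k'}(T)\equiv\mathrm{li}_{\mathbf k ш \mathbf k'}(T)\pmod{\mathcal R_{k+k',\,k+k'-1}}.$$ -/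

import Mathlib

open Polynomial

noncomputable section

namespace FiniteMultiplePolylog

/-! ### Rings of families indexed by the primes, modulo almost everywhere vanishing families -/

instance factPrime (p : Nat.Primes) : Fact (p : ℕ).Prime := ⟨p.2⟩

/-- The ideal `⨁ₚ Rₚ` of `∏ₚ Rₚ`: the families with only finitely many nonzero components. -/
def sumIdeal (R : Nat.Primes → Type) [∀ p, CommRing (R p)] : Ideal (∀ p, R p) where
  carrier := {f | {p | f p ≠ 0}.Finite}
  zero_mem' := by simp
  add_mem' := by
    intro f g hf hg
    refine (Set.Finite.union hf hg).subset ?_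
    intro p hp
    by_contra h
    simp only [Set.mem_union, Set.mem_ofPred_eq, not_or, not_not] at h
    exact hp (by simp [h.1, h.2])
  smul_mem' := by
    intro c f hf
    refine Set.Finite.subset hf ?_
    intro p hp h
    exact hp (by simp [h])

/-- The quotient ring `∏ₚ Rₚ / ⨁ₚ Rₚ`. -/
abbrev ModSum (R : Nat.Primes → Type) [∀ p, CommRing (R p)] : Type :=
  (∀ p, R p) ⧸ sumIdeal R

/-- The class of a family `(fₚ)ₚ`. -/
abbrev cls {R : Nat.Primes → Type} [∀ p, CommRing (R p)] (f : ∀ p, R p) : ModSum R :=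
  Ideal.Quotient.mk (sumIdeal R) f

/-- If `Rₚ` is an `𝔽ₚ`-algebra for every `p`, nonzero integers are invertible in the quotient. -/
theorem isUnit_intCast (R : Nat.Primes → Type) [∀ p, CommRing (R p)]
    [∀ p : Nat.Primes, Algebra (ZMod p) (R p)] (n : ℤ) (hn : n ≠ 0) :
    IsUnit ((Int.castRingHom (ModSum R)) n) := by
  refine IsUnit.of_mul_eq_one
    (cls (fun p : Nat.Primes => algebraMap (ZMod p) (R p) ((n : ZMod p)⁻¹))) ?_
  have h1 : (Int.castRingHom (ModSum R)) n = cls (fun p => ((n : ℤ) : R p)) := by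
    rw [eq_intCast, ← map_intCast (Ideal.Quotient.mk (sumIdeal R)) n]
    rfl
  rw [h1, cls, cls, ← map_mul, ← map_one (Ideal.Quotient.mk (sumIdeal R)), Ideal.Quotient.eq]
  have hfin : {p : Nat.Primes | (p : ℕ) ∣ n.natAbs}.Finite := by
    refine Set.Finite.of_finite_image (f := fun p : Nat.Primes => (p : ℕ)) ?_
      (fun a _ b _ h => Subtype.ext h)
    refine (Set.finite_Iic n.natAbs).subset ?_
    rintro _ ⟨p, hp, rfl⟩
    exact Nat.le_of_dvd (Int.natAbs_pos.mpr hn) hp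
  refine hfin.subset ?_
  intro p hp
  by_contra h
  apply hp
  have hne : ((n : ℤ) : ZMod p) ≠ 0 := by
    intro h0
    exact h (Int.natCast_dvd.mp ((ZMod.intCast_zmod_eq_zero_iff_dvd n p).mp h0))
  have : ((n : ℤ) : R p) = algebraMap (ZMod p) (R p) ((n : ℤ) : ZMod p) := by simp
  simp only [Pi.sub_apply, Pi.mul_apply, Pi.one_apply]
  rw [this, ← map_mul, mul_inv_cancel₀ hne, map_one, sub_self]

/-- The `ℚ`-algebra structure of `∏ₚ Rₚ / ⨁ₚ Rₚ` (there is at most one such structure). -/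
instance ratAlgebra (R : Nat.Primes → Type) [∀ p, CommRing (R p)]
    [∀ p : Nat.Primes, Algebra (ZMod p) (R p)] : Algebra ℚ (ModSum R) :=
  (IsLocalization.lift (M := nonZeroDivisors ℤ) (S := ℚ) (g := Int.castRingHom (ModSum R))
    (fun y => isUnit_intCast R y (nonZeroDivisors.ne_zero y.2))).toAlgebra

/-- `𝒜 = ∏ₚ 𝔽ₚ / ⨁ₚ 𝔽ₚ`. -/
abbrev RingA : Type := ModSum (fun p : Nat.Primes => ZMod p)

/-- `ℬ = ∏ₚ 𝔽ₚ[T] / ⨁ₚ 𝔽ₚ[T]`. -/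
abbrev RingB : Type := ModSum (fun p : Nat.Primes => (ZMod p)[X])

/-- The natural map `𝒜 → ℬ`, sending `(aₚ)ₚ` to the family of constant polynomials `aₚ`. -/
def constants : RingA →+* RingB :=
  Ideal.quotientMap (sumIdeal (fun p : Nat.Primes => (ZMod p)[X]))
    (RingHom.pi (fun p : Nat.Primes =>
      (C : ZMod p →+* (ZMod p)[X]).comp (Pi.evalRingHom (fun p : Nat.Primes => ZMod p) p)))
    (by
      intro f hf
      refine Set.Finite.subset hf ?_
      intro p hp h
      have h' : f p = 0 := h
      exact hp (show C (f p) = 0 by rw [h', map_zero]))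

/-- The element `T ^ p` of `ℬ`, whose `p`-component is `T ^ p`. -/
def Tp : RingB := cls (fun p : Nat.Primes => (X : (ZMod p)[X]) ^ (p : ℕ))

/-! ### Indices, finite multiple polylogarithms, finite multiple zeta values -/

/-- An index is a finite, possibly empty, sequence `(k₁, …, kᵣ)` of positive integers. -/
abbrev Index : Type := List ℕ+

/-- The weight `k₁ + ⋯ + kᵣ`. -/
def wt (k : Index) : ℕ := (k.map (fun a : ℕ+ => (a : ℕ))).sum

/-- `l₁ ^ k₁ (l₁ + l₂) ^ k₂ ⋯ (l₁ + ⋯ + lᵣ) ^ kᵣ`. -/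
def denom (k : Index) (l : Fin k.length → ℕ) : ℕ :=
  ∏ i : Fin k.length, (∑ j ∈ Finset.Iic i, l j) ^ (k.get i : ℕ)

/-- The tuples `(l₁, …, lᵣ)` with `0 < l₁, …, lᵣ < p`. -/
def box (r p : ℕ) : Finset (Fin r → ℕ) := Fintype.piFinset (fun _ => Finset.Ioo 0 p)

/-- The `p`-component of `liₖ(T)`: the sum of `T ^ (l₁ + ⋯ + lᵣ) / denom` over the tuples in the
box whose denominator is prime to `p`. -/
def liComp (k : Index) (p : ℕ) [Fact p.Prime] : (ZMod p)[X] :=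
  ∑ l ∈ (box k.length p).filter (fun l => (denom k l).Coprime p),
    C ((denom k l : ZMod p)⁻¹) * X ^ (∑ i, l i)

/-- The finite multiple polylogarithm `liₖ(T) ∈ ℬ`. -/
def li (k : Index) : RingB := cls (fun p : Nat.Primes => liComp k p)

/-- The `p`-component of `ζ_𝒜(k)`. -/
def zetaComp (k : Index) (p : ℕ) [Fact p.Prime] : ZMod p :=
  ∑ l ∈ (box k.length p).filter (fun l => ∑ i, l i < p), (denom k l : ZMod p)⁻¹

/-- The finite multiple zeta value `ζ_𝒜(k) ∈ 𝒜`. -/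
def zetaA (k : Index) : RingA := cls (fun p : Nat.Primes => zetaComp k p)

/-- The `ℚ`-subspace `ℛ_{a,b}` of `ℬ` spanned by the products `ζ_𝒜(k) (T ^ p) ^ n liₖ'(T)` with
`wt k + wt k' = a` and `wt k' ≤ b`. The bound `b` is an integer, so that `ℛ_{0,-1} = 0`. -/
def filtR (a : ℕ) (b : ℤ) : Submodule ℚ RingB :=
  Submodule.span ℚ {f : RingB | ∃ (k k' : Index) (n : ℕ),
    wt k + wt k' = a ∧ (wt k' : ℤ) ≤ b ∧ f = constants (zetaA k) * Tp ^ n * li k'}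

/-! ### The shuffle product -/

/-- The two letters `x` and `y`. -/
inductive Letter : Type
  | x : Letter
  | y : Letter

/-- The noncommutative polynomial ring `ℚ⟨x, y⟩`. -/
abbrev H : Type := MonoidAlgebra ℚ (FreeMonoid Letter)

/-- A word, as an element of `ℚ⟨x, y⟩`. -/
def word (w : List Letter) : H := MonoidAlgebra.single (FreeMonoid.ofList w) 1

/-- The shuffle product of two words. -/
def shuffleWord : List Letter → List Letter → H
  | [], w => word w
  | u :: w, [] => word (u :: w)
  | u₁ :: w₁, u₂ :: w₂ =>
      word [u₁] * shuffleWord w₁ (u₂ :: w₂) + word [u₂] * shuffleWord (u₁ :: w₁) w₂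
termination_by w₁ w₂ => w₁.length + w₂.length

/-- The shuffle product on `ℚ⟨x, y⟩`, the bilinear extension of `shuffleWord`. -/
def shuffle (f g : H) : H :=
  f.coeff.sum fun w₁ a => g.coeff.sum fun w₂ b =>
    (a * b) • shuffleWord (FreeMonoid.toList w₁) (FreeMonoid.toList w₂)

/-- The word `x ^ (k₁ - 1) y x ^ (k₂ - 1) y ⋯ x ^ (kᵣ - 1) y`. -/
def blocks : List ℕ+ → List Letter
  | [] => []
  | a :: k => List.replicate ((a : ℕ) - 1) Letter.x ++ Letter.y :: blocks k

/-- The word of the index `(k₁, …, kᵣ)`, namely `x ^ (kᵣ - 1) y ⋯ x ^ (k₁ - 1) y`. The order is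
reversed because the last entry of an index belongs to the largest denominator. -/
def indexWord (k : Index) : FreeMonoid Letter := FreeMonoid.ofList (blocks k.reverse)

theorem blocks_injective : Function.Injective blocks := by
  have key : ∀ (m n : ℕ) (u v : List Letter),
      List.replicate m Letter.x ++ Letter.y :: u = List.replicate n Letter.x ++ Letter.y :: v →
        m = n ∧ u = v := by
    intro m
    induction m with
    | zero =>
      intro n u v h
      cases n with
      | zero => simpa using h
      | succ n => simp [List.replicate_succ] at h
    | succ m ih =>
      intro n u v h
      cases n with
      | zero => simp [List.replicate_succ] at h
      | succ n =>
        simp only [List.replicate_succ, List.cons_append, List.cons.injEq, true_and] at h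
        obtain ⟨h1, h2⟩ := ih n u v h
        exact ⟨by rw [h1], h2⟩
  intro k
  induction k with
  | nil =>
    intro l h
    cases l with
    | nil => rfl
    | cons b l => simp [blocks] at h
  | cons a k ih =>
    intro l h
    cases l with
    | nil => simp [blocks] at h
    | cons b l =>
      obtain ⟨h1, h2⟩ := key _ _ _ _ h
      have ha := a.pos
      have hb := b.pos
      have hab : a = b := PNat.eq (by omega)
      rw [hab, ih h2]

theorem indexWord_injective : Function.Injective indexWord := by
  intro k l h
  exact List.reverse_injective (blocks_injective h)

/-- The shuffle product of two indices: the formal `ℚ`-linear combination of indices in which the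
coefficient of `l` is the coefficient of the word of `l` in the shuffle product of the words of
`k` and `k'`. -/
def shuffleIndex (k k' : Index) : Index →₀ ℚ :=
  Finsupp.comapDomain indexWord
    (shuffle (MonoidAlgebra.single (indexWord k) 1) (MonoidAlgebra.single (indexWord k') 1)).coeff
    indexWord_injective.injOn

/-- The extension of `li` to formal `ℚ`-linear combinations of indices. -/
def liSum (s : Index →₀ ℚ) : RingB := s.sum fun l c => c • li l

end FiniteMultiplePolylog

end

/-! Write I for `integ` (divide the coefficient of T^m by m, with 0⁻¹ = 0) and P for `proj` (keep
the exponents divisible by p). Each li is an iterated integral: reading its word from the right and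
starting from 1, the letter x applies I, and the letter y multiplies by g = T + ⋯ + T^(p-1) and then
applies I. If I were a genuine integral, integration by parts would give the shuffle product
exactly. Instead `integ_mul_integ` has three correction terms, all involving P, and the proof by
recursion on the shuffle (`wordB_mul_wordB_sub_mem_filtR`) reduces to placing them in the
filtration.

The point is that P of a product of two words is a combination of ζ_𝒜(l)(T^p)^n of the right weight.
Since P(I f · h) = -P(f · I h), letters can be moved from one word to the other until only P(letter
· word) is left (`projB_wordB_mul_letterB_mul_wordB_mem_filtR`). For the letter x this is trivial.
For y, every nonempty word expands into truncated polylogarithms, of degree less than p, with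
coefficients ζ_𝒜(l)(T^p)^n (`wordB_mem_truncSpan`), and P(g · truncated polylogarithm) is T^p times
a zeta value. Products of zeta values that arise on the way are made linear by the quasi-shuffle
product (`zetaB_mul`). -/

noncomputable section

namespace FiniteMultiplePolylog

/-! ### Diagonal operators on polynomials -/

section Diagonal

variable {R : Type*} [CommRing R]

/-- The operator multiplying the coefficient of `X ^ m` by `c m`. -/
def diagonal (c : ℕ → R) : R[X] →ₗ[R] R[X] :=
  Polynomial.lsum fun m => (monomial m).comp (LinearMap.mulLeft R (c m))

@[simp]
theorem diagonal_monomial (c : ℕ → R) (m : ℕ) (a : R) :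
    diagonal c (monomial m a) = monomial m (c m * a) := by
  simp [diagonal, Polynomial.lsum_apply, Polynomial.sum_monomial_index]

theorem coeff_diagonal (c : ℕ → R) (f : R[X]) (m : ℕ) :
    (diagonal c f).coeff m = c m * f.coeff m := by
  induction f using Polynomial.induction_on' with
  | add f h hf hh => simp [hf, hh, mul_add]
  | monomial n a =>
    rw [diagonal_monomial, coeff_monomial, coeff_monomial]
    split_ifs with h
    · rw [h]
    · simp

theorem diagonal_C_mul (c : ℕ → R) (a : R) (f : R[X]) :
    diagonal c (C a * f) = C a * diagonal c f := by
  rw [← smul_eq_C_mul, map_smul, smul_eq_C_mul]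

theorem diagonal_C_mul_X_pow (c : ℕ → R) (a : R) (m : ℕ) :
    diagonal c (C a * X ^ m) = C (c m * a) * X ^ m := by
  rw [C_mul_X_pow_eq_monomial, diagonal_monomial, C_mul_X_pow_eq_monomial]

theorem diagonal_X_pow_mul (c : ℕ → R) (n : ℕ) (hc : ∀ m, c (n + m) = c m) (f : R[X]) :
    diagonal c (X ^ n * f) = X ^ n * diagonal c f := by
  induction f using Polynomial.induction_on' with
  | add f h hf hh => simp only [map_add, mul_add, hf, hh]
  | monomial m a =>
    rw [X_pow_eq_monomial, monomial_mul_monomial, diagonal_monomial, diagonal_monomial,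
      monomial_mul_monomial, hc]
    simp

end Diagonal

/-! ### Sums over boxes, one variable at a time -/

theorem sum_box_succ (p : ℕ) {M : Type*} [AddCommMonoid M] (r : ℕ) (F : (Fin (r + 1) → ℕ) → M) :
    ∑ l ∈ box (r + 1) p, F l = ∑ l ∈ box r p, ∑ x ∈ Finset.Ioo 0 p, F (Fin.snoc l x) := by
  rw [← Finset.sum_product']
  refine Finset.sum_bij' (fun l _ => (Fin.init l, l (Fin.last r)))
    (fun q _ => Fin.snoc q.1 q.2) ?_ ?_ ?_ ?_ ?_
  · intro l hl
    simp only [box, Fintype.mem_piFinset, Finset.mem_product] at hl ⊢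
    exact ⟨fun i => hl _, hl _⟩
  · intro q hq
    simp only [box, Fintype.mem_piFinset, Finset.mem_product] at hq ⊢
    intro i
    refine Fin.lastCases ?_ (fun i => ?_) i
    · simpa using hq.2
    · simpa using hq.1 i
  · intro l _
    simp
  · intro q _
    simp
  · intro l _
    simp

theorem sum_Iic_castSucc_snoc {r : ℕ} (l : Fin r → ℕ) (x : ℕ) (i : Fin r) :
    ∑ j ∈ Finset.Iic i.castSucc, (Fin.snoc l x : Fin (r + 1) → ℕ) j
      = ∑ j ∈ Finset.Iic i, l j := by
  rw [← Fin.map_castSuccEmb_Iic, Finset.sum_map]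
  simp

/-! ### Integration and projection for a single prime -/

section Prime

variable (p : ℕ) [Fact p.Prime]

/-- The operator `X ^ m ↦ m⁻¹ X ^ m`, which kills `X ^ m` if `p ∣ m`. -/
def integ : (ZMod p)[X] →ₗ[ZMod p] (ZMod p)[X] := diagonal fun m => ((m : ZMod p))⁻¹

/-- The projection to the span of the monomials whose exponent is divisible by `p`. -/
def proj : (ZMod p)[X] →ₗ[ZMod p] (ZMod p)[X] :=
  diagonal fun m => if (m : ZMod p) = 0 then 1 else 0

/-- The polynomial `X + ⋯ + X ^ (p - 1)`. -/
def geom : (ZMod p)[X] := ∑ l ∈ Finset.Ioo 0 p, X ^ l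

theorem integ_X_pow_mul (f : (ZMod p)[X]) : integ p (X ^ p * f) = X ^ p * integ p f :=
  diagonal_X_pow_mul _ p (by simp) f

theorem proj_X_pow_mul (f : (ZMod p)[X]) : proj p (X ^ p * f) = X ^ p * proj p f :=
  diagonal_X_pow_mul _ p (by simp) f

theorem proj_integ (f : (ZMod p)[X]) : proj p (integ p f) = 0 := by
  ext m
  simp only [proj, integ, coeff_diagonal, coeff_zero]
  split_ifs with h <;> simp [h]

theorem integ_one : integ p 1 = 0 := by
  rw [integ, ← C_1, ← monomial_zero_left, diagonal_monomial]
  simp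

theorem proj_one : proj p 1 = 1 := by
  rw [proj, ← C_1, ← monomial_zero_left, diagonal_monomial]
  simp

theorem natCast_ne_zero_of_mem_Ioo {n : ℕ} (hn : n ∈ Finset.Ioo 0 p) : (n : ZMod p) ≠ 0 := by
  rw [Finset.mem_Ioo] at hn
  rw [Ne, ZMod.natCast_eq_zero_iff]
  exact Nat.not_dvd_of_pos_of_lt hn.1 hn.2

theorem proj_geom : proj p (geom p) = 0 := by
  rw [geom, map_sum]
  refine Finset.sum_eq_zero fun l hl => ?_
  rw [proj, X_pow_eq_monomial, diagonal_monomial, if_neg (natCast_ne_zero_of_mem_Ioo p hl)]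
  simp

/-- Integration by parts modulo `p`-th powers. -/
theorem proj_integ_mul (f h : (ZMod p)[X]) :
    proj p (integ p f * h) = -proj p (f * integ p h) := by
  induction f using Polynomial.induction_on' with
  | add f₁ f₂ h₁ h₂ => simp only [map_add, add_mul, h₁, h₂, neg_add]
  | monomial m a =>
    induction h using Polynomial.induction_on' with
    | add f₁ f₂ h₁ h₂ => simp only [map_add, mul_add, h₁, h₂, neg_add]
    | monomial n b =>
      simp only [proj, integ, diagonal_monomial, monomial_mul_monomial, ← map_neg]
      congr 1
      split_ifs with hmn
      -- On a surviving exponent n = -m in 𝔽_p, so the two inverses are opposite; this includes m =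
      -- n = 0, where both are 0.
      · have : (n : ZMod p) = -m := by
          push_cast at hmn
          linear_combination hmn
        rw [this, inv_neg]
        ring
      · simp

/-- The Rota–Baxter identity for `integ`, with its correction terms. -/
theorem integ_mul_integ (f h : (ZMod p)[X]) :
    integ p f * integ p h = integ p (f * integ p h) + integ p (integ p f * h)
      - proj p f * integ p (integ p h) - proj p h * integ p (integ p f)
      + proj p (integ p f * integ p h) := by
  induction f using Polynomial.induction_on' with
  | add f₁ f₂ h₁ h₂ =>
    simp only [map_add, add_mul, mul_add]
    linear_combination h₁ + h₂
  | monomial m a =>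
    induction h using Polynomial.induction_on' with
    | add f₁ f₂ h₁ h₂ =>
      simp only [map_add, add_mul, mul_add]
      linear_combination h₁ + h₂
    | monomial n b =>
      simp only [proj, integ, diagonal_monomial, monomial_mul_monomial]
      rw [Nat.add_comm n m]
      simp only [← map_add, ← map_sub]
      congr 1
      push_cast
      -- Generically this is 1/(mn) = 1/((m+n)n) + 1/((m+n)m). The corrections with `proj p f` and
      -- `proj p h` compensate for m = 0 or n = 0, the last one for m + n = 0.
      by_cases hm : (m : ZMod p) = 0
      · by_cases hn : (n : ZMod p) = 0
        · simp [hm, hn]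
        · simp [hm, hn]
          ring
      · by_cases hn : (n : ZMod p) = 0
        · simp [hm, hn]
          ring
        · by_cases hmn : (m : ZMod p) + n = 0
          · simp [hm, hn, hmn]
          · simp [hm, hn, hmn]
            field_simp

/-! ### Polynomials of words -/

/-- The polynomial by which a letter multiplies before `integ` is applied. -/
def letterPoly : Letter → (ZMod p)[X]
  | Letter.x => 1
  | Letter.y => geom p

/-- The polynomial of a word. -/
def wordPoly : List Letter → (ZMod p)[X]
  | [] => 1
  | c :: w => integ p (letterPoly p c * wordPoly w)

theorem wordPoly_replicate_append (n : ℕ) (w : List Letter) :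
    wordPoly p (List.replicate n Letter.x ++ w) = (integ p)^[n] (wordPoly p w) := by
  induction n with
  | zero => simp
  | succ n ih =>
    rw [Function.iterate_succ_apply', ← ih, List.replicate_succ, List.cons_append, wordPoly,
      letterPoly, one_mul]

theorem wordPoly_blocks_cons (a : ℕ+) (k : List ℕ+) :
    wordPoly p (blocks (a :: k)) = (integ p)^[(a : ℕ)] (geom p * wordPoly p (blocks k)) := by
  rw [blocks, wordPoly_replicate_append, wordPoly, letterPoly, ← Function.iterate_succ_apply]
  congr 2
  have := a.pos
  omega

theorem iterate_integ_C_mul_X_pow (n : ℕ) (a : ZMod p) (m : ℕ) :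
    (integ p)^[n] (C a * X ^ m) = C (((m : ZMod p)⁻¹) ^ n * a) * X ^ m := by
  induction n with
  | zero => simp
  | succ n ih =>
    rw [Function.iterate_succ_apply', ih, integ, diagonal_C_mul_X_pow, pow_succ']
    ring_nf

theorem coeff_iterate_integ (n : ℕ) (f : (ZMod p)[X]) (m : ℕ) :
    ((integ p)^[n] f).coeff m = ((m : ZMod p)⁻¹) ^ n * f.coeff m := by
  induction n with
  | zero => simp
  | succ n ih =>
    rw [Function.iterate_succ_apply', integ, coeff_diagonal, ← integ, ih, pow_succ']
    ring

theorem iterate_integ_sum {ι : Type*} (n : ℕ) (s : Finset ι) (f : ι → (ZMod p)[X]) :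
    (integ p)^[n] (∑ i ∈ s, f i) = ∑ i ∈ s, (integ p)^[n] (f i) := by
  simp only [← Module.End.coe_pow, map_sum]

/-- The sum over a box in terms of which `liComp` is expressed, for a tuple of exponents. -/
def boxPoly (r : ℕ) (e : Fin r → ℕ) : (ZMod p)[X] :=
  ∑ l ∈ box r p, C (((∏ i, (∑ j ∈ Finset.Iic i, l j) ^ e i : ℕ) : ZMod p)⁻¹) * X ^ (∑ i, l i)

/-- The coprimality condition is absorbed by 0⁻¹ = 0: excluded terms have denominator 0 in 𝔽_p. -/
theorem liComp_eq_boxPoly (k : Index) :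
    liComp k p = boxPoly p k.length fun i => (k.get i : ℕ) := by
  rw [liComp, boxPoly, Finset.sum_filter]
  refine Finset.sum_congr rfl fun l _ => ?_
  rw [← denom]
  split_ifs with h
  · rfl
  · rw [Nat.coprime_comm, Nat.Prime.coprime_iff_not_dvd Fact.out, not_not,
      ← ZMod.natCast_eq_zero_iff] at h
    simp [h]

/-- Multiplication by `geom p` adds the last variable to the exponent, which is then the full sum l₁
+ ⋯ + lᵣ₊₁; iterating `integ` divides by a power of that sum, the last factor of the denominator. -/
theorem boxPoly_succ (r : ℕ) (e : Fin (r + 1) → ℕ) :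
    boxPoly p (r + 1) e
      = (integ p)^[e (Fin.last r)] (geom p * boxPoly p r (Fin.init e)) := by
  rw [boxPoly, sum_box_succ, boxPoly, geom, Finset.mul_sum, iterate_integ_sum]
  refine Finset.sum_congr rfl fun l _ => ?_
  rw [Finset.sum_mul, iterate_integ_sum]
  refine Finset.sum_congr rfl fun x _ => ?_
  have h : ∀ a : ZMod p, X ^ x * (C a * X ^ (∑ i, l i)) = C a * X ^ (∑ i, l i + x) := by
    intro a
    ring
  have hl : Finset.Iic (Fin.last r) = Finset.univ := by
    ext i
    simp [Fin.le_last]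
  rw [h, iterate_integ_C_mul_X_pow, Fin.prod_univ_castSucc, hl, Fin.sum_univ_castSucc]
  simp only [sum_Iic_castSucc_snoc, Fin.snoc_castSucc, Fin.snoc_last, Fin.init]
  push_cast
  congr 2
  rw [mul_inv, inv_pow, mul_comm]

theorem boxPoly_cast {r s : ℕ} (h : r = s) (e : Fin s → ℕ) :
    boxPoly p r (fun i => e (Fin.cast h i)) = boxPoly p s e := by
  subst h
  rfl

theorem liComp_eq_wordPoly (k : Index) : liComp k p = wordPoly p (blocks k.reverse) := by
  rw [liComp_eq_boxPoly]
  induction k using List.reverseRecOn with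
  | nil => simp [boxPoly, box, blocks, wordPoly]
  | append_singleton k a ih =>
    rw [List.reverse_append, List.reverse_singleton, List.singleton_append,
      wordPoly_blocks_cons, ← ih]
    have hlen : (k ++ [a]).length = k.length + 1 := by simp
    refine (boxPoly_cast p hlen fun j =>
      (((k ++ [a]).get (Fin.cast hlen.symm j) : ℕ+) : ℕ)).trans ?_
    rw [boxPoly_succ]
    have h1 : (k ++ [a]).get (Fin.cast hlen.symm (Fin.last k.length)) = a := by simp
    rw [h1]
    congr 3
    funext i
    simp [Fin.init]

/-! ### Truncated harmonic sums -/

/-- The sum of `n₁ ^ (-k₁) n₂ ^ (-k₂) ⋯` over `N > n₁ > n₂ > ⋯ ≥ 0`. -/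
def harm : List ℕ+ → ℕ → ZMod p
  | [], _ => 1
  | a :: k, N => ∑ n ∈ Finset.range N, ((n : ZMod p)⁻¹) ^ (a : ℕ) * harm k n

theorem harm_cons_succ (a : ℕ+) (k : List ℕ+) (N : ℕ) :
    harm p (a :: k) (N + 1) = harm p (a :: k) N + ((N : ZMod p)⁻¹) ^ (a : ℕ) * harm p k N := by
  rw [harm, harm, Finset.sum_range_succ]

/-- The bound m < p ensures that each n < m is reached, through the monomial of exponent m - n < p.
-/
theorem coeff_geom_mul (f : (ZMod p)[X]) {m : ℕ} (hm : m < p) :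
    (geom p * f).coeff m = ∑ n ∈ Finset.range m, f.coeff n := by
  rw [geom, Finset.sum_mul, finsetSum_coeff]
  simp only [coeff_X_pow_mul']
  rw [← Finset.sum_filter]
  refine Finset.sum_bij' (fun l _ => m - l) (fun n _ => m - n) ?_ ?_ ?_ ?_ ?_ <;>
    intro l hl <;> simp only [Finset.mem_filter, Finset.mem_Ioo, Finset.mem_range] at * <;> omega

theorem sum_coeff_wordPoly_blocks (k : List ℕ+) {N : ℕ} (hN : 0 < N) (hp : N ≤ p) :
    ∑ m ∈ Finset.range N, (wordPoly p (blocks k)).coeff m = harm p k N := by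
  induction k generalizing N with
  | nil => simp [blocks, wordPoly, harm, coeff_one, hN]
  | cons a k ih =>
    rw [harm]
    refine Finset.sum_congr rfl fun m hm => ?_
    rw [Finset.mem_range] at hm
    rw [wordPoly_blocks_cons, coeff_iterate_integ, coeff_geom_mul p _ (hm.trans_le hp)]
    -- At m = 0 the induction hypothesis is not available, but the factor (0⁻¹)^a vanishes because a
    -- is positive.
    rcases Nat.eq_zero_or_pos m with rfl | h0
    · simp
    · rw [ih h0 (hm.le.trans hp)]

theorem zetaComp_eq_sum_coeff (k : Index) :
    zetaComp k p = ∑ m ∈ Finset.range p, (liComp k p).coeff m := by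
  rw [liComp_eq_boxPoly, boxPoly]
  simp only [finsetSum_coeff]
  rw [Finset.sum_comm, zetaComp, Finset.sum_filter]
  refine Finset.sum_congr rfl fun l _ => ?_
  simp only [coeff_C_mul, coeff_X_pow, mul_ite, mul_one, mul_zero, Finset.sum_ite_eq',
    Finset.mem_range]
  rfl

theorem zetaComp_eq_harm (k : Index) : zetaComp k p = harm p k.reverse p := by
  rw [zetaComp_eq_sum_coeff, liComp_eq_wordPoly]
  exact sum_coeff_wordPoly_blocks p _ (Nat.Prime.pos Fact.out) le_rfl

/-- The terms of the quasi-shuffle product of two lists. -/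
def stuffle : List ℕ+ → List ℕ+ → List (List ℕ+)
  | [], k => [k]
  | a :: k, [] => [a :: k]
  | a :: k, b :: l => (stuffle k (b :: l)).map (a :: ·) ++ (stuffle (a :: k) l).map (b :: ·)
      ++ (stuffle k l).map ((a + b) :: ·)
termination_by k l => k.length + l.length

theorem sum_harm_cons_zero (a : ℕ+) (L : List (List ℕ+)) :
    ((L.map (a :: ·)).map (harm p · 0)).sum = 0 := by
  induction L with
  | nil => simp
  | cons k L ih => simpa [harm] using ih

theorem sum_harm_cons_succ (a : ℕ+) (L : List (List ℕ+)) (N : ℕ) :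
    ((L.map (a :: ·)).map (harm p · (N + 1))).sum = ((L.map (a :: ·)).map (harm p · N)).sum
      + ((N : ZMod p)⁻¹) ^ (a : ℕ) * (L.map (harm p · N)).sum := by
  induction L with
  | nil => simp
  | cons k L ih =>
    simp only [List.map_cons, List.sum_cons, ih, harm_cons_succ]
    ring

/-- Induction on the truncation N: by the discrete Leibniz rule, the increment of the product has
three terms, one for each branch of `stuffle`. -/
theorem harm_mul_harm (k l : List ℕ+) (N : ℕ) :
    harm p k N * harm p l N = ((stuffle k l).map (harm p · N)).sum := by
  induction N generalizing k l with
  | zero =>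
    match k, l with
    | [], l => simp [stuffle, harm]
    | a :: k, [] => simp [stuffle, harm]
    | a :: k, b :: l =>
      rw [stuffle]
      simp only [List.map_append, List.sum_append, sum_harm_cons_zero]
      simp [harm]
  | succ N ih =>
    match k, l with
    | [], l => simp [stuffle, harm]
    | a :: k, [] => simp [stuffle, harm]
    | a :: k, b :: l =>
      have h := ih (a :: k) (b :: l)
      rw [stuffle] at h ⊢
      simp only [List.map_append, List.sum_append, sum_harm_cons_succ] at h ⊢
      rw [← ih, ← ih, ← ih, harm_cons_succ, harm_cons_succ, PNat.add_coe, pow_add]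
      linear_combination h

theorem wt_cons (a : ℕ+) (k : List ℕ+) : wt (a :: k) = a + wt k := by
  simp [wt]

theorem wt_of_mem_stuffle (k l m : List ℕ+) (hm : m ∈ stuffle k l) : wt m = wt k + wt l := by
  induction k, l using stuffle.induct generalizing m with
  | case1 k => simp_all [stuffle, wt]
  | case2 a k => simp_all [stuffle, wt]
  | case3 a k b l ih₁ ih₂ ih₃ =>
    rw [stuffle] at hm
    simp only [List.mem_append, List.mem_map] at hm
    rcases hm with (⟨n, hn, rfl⟩ | ⟨n, hn, rfl⟩) | ⟨n, hn, rfl⟩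
    · rw [wt_cons, ih₁ n hn, wt_cons a k]
      ring
    · rw [wt_cons, ih₂ n hn, wt_cons b l]
      ring
    · rw [wt_cons, ih₃ n hn, wt_cons a k, wt_cons b l, PNat.add_coe]
      ring

/-! ### Truncated polylogarithms -/

/-- The polynomial `∑ X ^ n₁ / (n₁ ^ a n₂ ^ k₁ ⋯)` over `p > n₁ > n₂ > ⋯ > 0`. -/
def truncPoly (a : ℕ+) (k : List ℕ+) : (ZMod p)[X] :=
  ∑ n ∈ Finset.range p, C (((n : ZMod p)⁻¹) ^ (a : ℕ) * harm p k n) * X ^ n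

theorem integ_truncPoly (a : ℕ+) (k : List ℕ+) :
    integ p (truncPoly p a k) = truncPoly p (a + 1) k := by
  rw [truncPoly, map_sum, truncPoly]
  refine Finset.sum_congr rfl fun n _ => ?_
  rw [integ, diagonal_C_mul_X_pow, PNat.add_coe, PNat.one_coe, pow_succ']
  ring_nf

theorem integ_sum_harm (k : List ℕ+) :
    integ p (∑ n ∈ Finset.range p, C (harm p k n) * X ^ n) = truncPoly p 1 k := by
  rw [map_sum, truncPoly]
  refine Finset.sum_congr rfl fun n _ => ?_
  rw [integ, diagonal_C_mul_X_pow, PNat.one_coe, pow_one]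

theorem proj_sum_C_mul_X_pow (f : ℕ → ZMod p) :
    proj p (∑ n ∈ Finset.range p, C (f n) * X ^ n) = C (f 0) := by
  rw [map_sum, Finset.sum_eq_single_of_mem 0
    (Finset.mem_range.mpr (Nat.Prime.pos Fact.out))]
  · rw [proj, diagonal_C_mul_X_pow]
    simp
  · intro n hn h0
    have : (n : ZMod p) ≠ 0 := natCast_ne_zero_of_mem_Ioo p
      (Finset.mem_Ioo.mpr ⟨Nat.pos_of_ne_zero h0, Finset.mem_range.mp hn⟩)
    rw [proj, diagonal_C_mul_X_pow, if_neg this]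
    simp

theorem integ_geom : integ p (geom p) = truncPoly p 1 [] := by
  rw [← integ_sum_harm]
  simp only [harm, C_1, one_mul]
  rw [Finset.range_eq_Ico, Finset.sum_eq_sum_Ico_succ_bot (Nat.Prime.pos Fact.out), map_add,
    pow_zero, integ_one, zero_add]
  rfl

/-- The exponents run from b + 1 to b + p - 1; they are cut at p. -/
theorem geom_mul_X_pow {b : ℕ} (h0 : 0 < b) (hb : b < p) :
    geom p * X ^ b = ∑ a ∈ Finset.Ico (b + 1) p, (X : (ZMod p)[X]) ^ a
      + X ^ p * ∑ a ∈ Finset.range b, X ^ a := by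
  have h1 : geom p * X ^ b = ∑ a ∈ Finset.Ico (b + 1) (b + p), (X : (ZMod p)[X]) ^ a := by
    rw [geom, Finset.sum_mul]
    refine Finset.sum_bij' (fun l _ => l + b) (fun a _ => a - b) ?_ ?_ ?_ ?_ ?_ <;>
      intro l hl <;> simp only [Finset.mem_Ioo, Finset.mem_Ico] at * <;> try omega
    rw [pow_add]
  have h2 : X ^ p * ∑ a ∈ Finset.range b, X ^ a
      = ∑ a ∈ Finset.Ico p (b + p), (X : (ZMod p)[X]) ^ a := by
    rw [Finset.mul_sum, Finset.sum_Ico_eq_sum_range, Nat.add_sub_cancel]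
    simp only [pow_add]
  rw [h1, h2, Finset.sum_Ico_consecutive _ (by omega) (by omega)]

/-- In the part of degree at least p the coefficients are tail sums over n > a. Writing a tail as
the full sum minus an initial sum makes the full sum, later a zeta value, appear. -/
theorem geom_mul_sum (f : ℕ → ZMod p) (hf : f 0 = 0) :
    geom p * ∑ n ∈ Finset.range p, C (f n) * X ^ n
      = ∑ a ∈ Finset.range p, C (∑ n ∈ Finset.range a, f n) * X ^ a
        + X ^ p * (C (∑ n ∈ Finset.range p, f n) * ∑ a ∈ Finset.range p, X ^ a
          - ∑ a ∈ Finset.range p, C (f a) * X ^ a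
          - ∑ a ∈ Finset.range p, C (∑ n ∈ Finset.range a, f n) * X ^ a) := by
  have hexp : ∑ a ∈ Finset.range p, C (∑ n ∈ Finset.range a, f n) * X ^ a
      = ∑ n ∈ Finset.range p, C (f n) * ∑ a ∈ Finset.Ico (n + 1) p, X ^ a := by
    simp only [map_sum, Finset.sum_mul, Finset.mul_sum]
    refine Finset.sum_comm' fun a n => ?_
    simp only [Finset.mem_range, Finset.mem_Ico]
    omega
  rw [hexp, map_sum, Finset.sum_mul, ← Finset.sum_sub_distrib, ← Finset.sum_sub_distrib,
    Finset.mul_sum, Finset.mul_sum, ← Finset.sum_add_distrib]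
  refine Finset.sum_congr rfl fun n hn => ?_
  rw [Finset.mem_range] at hn
  rcases Nat.eq_zero_or_pos n with rfl | h0
  · simp [hf]
  · have h1 := geom_mul_X_pow p h0 hn
    have h2 : ∑ a ∈ Finset.range p, (X : (ZMod p)[X]) ^ a = ∑ a ∈ Finset.range n, X ^ a + X ^ n
        + ∑ a ∈ Finset.Ico (n + 1) p, X ^ a := by
      rw [← Finset.sum_range_succ, Finset.sum_range_add_sum_Ico _ (by omega)]
    rw [h2]
    linear_combination C (f n) * h1

theorem geom_mul_truncPoly (b : ℕ+) (k : List ℕ+) :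
    geom p * truncPoly p b k
      = ∑ a ∈ Finset.range p, C (harm p (b :: k) a) * X ^ a
        + X ^ p * (C (harm p (b :: k) p) * ∑ a ∈ Finset.range p, C (harm p [] a) * X ^ a
          - truncPoly p b k - ∑ a ∈ Finset.range p, C (harm p (b :: k) a) * X ^ a) := by
  rw [truncPoly, geom_mul_sum p _ (by simp)]
  simp only [harm, C_1, one_mul]

theorem integ_geom_mul_truncPoly (b : ℕ+) (k : List ℕ+) :
    integ p (geom p * truncPoly p b k) = truncPoly p 1 (b :: k)
      + X ^ p * (C (harm p (b :: k) p) * truncPoly p 1 []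
        - truncPoly p (b + 1) k - truncPoly p 1 (b :: k)) := by
  rw [geom_mul_truncPoly, map_add, integ_X_pow_mul, map_sub, map_sub, integ_sum_harm,
    integ_truncPoly]
  conv_lhs => rw [integ, diagonal_C_mul, ← integ, integ_sum_harm]

/-- Below degree p only the constant term survives `proj`, and among the summands only the one with
the empty harmonic sum has a nonzero constant term. -/
theorem proj_geom_mul_truncPoly (b : ℕ+) (k : List ℕ+) :
    proj p (geom p * truncPoly p b k) = X ^ p * C (harm p (b :: k) p) := by
  rw [geom_mul_truncPoly, map_add, proj_X_pow_mul, map_sub, map_sub, proj_sum_C_mul_X_pow,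
    truncPoly, proj_sum_C_mul_X_pow]
  conv_lhs => rw [proj, diagonal_C_mul, ← proj, proj_sum_C_mul_X_pow]
  simp [harm]

end Prime

/-! ### The scalar multiplication of `ℬ` -/

/-- The scalar multiplication of the `ℚ`-algebra `ℬ`. -/
instance ratSMulB : SMul ℚ RingB := (ratAlgebra fun p : Nat.Primes => (ZMod p)[X]).toSMul

/-- The scalar multiplication which the quotient `ℬ` inherits from the partially defined actions
of `ℚ` on the fields `𝔽ₚ` is that of the `ℚ`-algebra `ℬ`. -/
theorem quotient_smul_eq (r : ℚ) (f : RingB) :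
    @HSMul.hSMul ℚ RingB RingB (@instHSMul ℚ RingB (Submodule.Quotient.instSMul'
      (sumIdeal fun p : Nat.Primes => (ZMod p)[X]))) r f = r • f := by
  obtain ⟨f, rfl⟩ := Ideal.Quotient.mk_surjective f
  have hden := isUnit_intCast (fun p : Nat.Primes => (ZMod p)[X]) (r.den : ℤ)
    (by exact_mod_cast r.den_ne_zero)
  -- After clearing the denominator, the two sides agree at every p not dividing it, that is, at all
  -- but finitely many p.
  refine hden.mul_left_cancel ?_
  have h1 : Int.castRingHom RingB (r.den : ℤ) = algebraMap ℚ RingB r.den := by simp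
  rw [h1, Algebra.smul_def, ← mul_assoc, ← map_mul, Rat.den_mul_eq_num, map_natCast, map_intCast]
  change cls (fun p : Nat.Primes => (r.den : (ZMod p)[X]) * (r • f p))
    = cls (fun p : Nat.Primes => (r.num : (ZMod p)[X]) * f p)
  rw [cls, cls, Ideal.Quotient.eq]
  have hfin : {p : Nat.Primes | (p : ℕ) ∣ r.den}.Finite := by
    refine Set.Finite.of_finite_image (f := fun p : Nat.Primes => (p : ℕ)) ?_
      (fun a _ b _ h => Subtype.ext h)
    refine (Set.finite_Iic r.den).subset ?_
    rintro _ ⟨p, hp, rfl⟩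
    exact Nat.le_of_dvd r.den_pos hp
  refine hfin.subset fun p hp => ?_
  by_contra h
  apply hp
  have hne : (r.den : ZMod p) ≠ 0 := fun h0 => h ((ZMod.natCast_eq_zero_iff _ _).mp h0)
  simp only [Pi.sub_apply]
  rw [sub_eq_zero]
  ext m
  rw [← C_eq_natCast, ← C_eq_intCast, coeff_C_mul, coeff_C_mul, coeff_smul, Rat.smul_def,
    Rat.cast_def]
  field_simp

/-! ### Operators on `ℬ` -/

/-- The endomorphism of `ℬ` induced by a family of additive endomorphisms. -/
def mapB (φ : ∀ p : Nat.Primes, (ZMod p)[X] →ₗ[ZMod p] (ZMod p)[X]) : RingB →ₗ[ℚ] RingB :=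
  AddMonoidHom.toRatLinearMap
    (QuotientAddGroup.map (sumIdeal fun p : Nat.Primes => (ZMod p)[X]).toAddSubgroup
      (sumIdeal fun p : Nat.Primes => (ZMod p)[X]).toAddSubgroup
      (AddMonoidHom.pi fun p : Nat.Primes =>
        (φ p).toAddMonoidHom.comp (Pi.evalAddMonoidHom (fun p : Nat.Primes => (ZMod p)[X]) p))
      (by
        intro f hf
        refine Set.Finite.subset hf ?_
        intro p hp h
        have h' : f p = 0 := h
        exact hp (show φ p (f p) = 0 by rw [h', map_zero])))

theorem mapB_cls (φ : ∀ p : Nat.Primes, (ZMod p)[X] →ₗ[ZMod p] (ZMod p)[X])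
    (f : ∀ p : Nat.Primes, (ZMod p)[X]) : mapB φ (cls f) = cls fun p => φ p (f p) := rfl

theorem constants_cls (f : ∀ p : Nat.Primes, ZMod p) :
    constants (cls f) = cls fun p : Nat.Primes => C (f p) := rfl

theorem exists_cls {R : Nat.Primes → Type} [∀ p, CommRing (R p)] (b : ModSum R) :
    ∃ f : ∀ p, R p, cls f = b := Ideal.Quotient.mk_surjective b

theorem cls_add {R : Nat.Primes → Type} [∀ p, CommRing (R p)] (f g : ∀ p, R p) :
    cls f + cls g = cls fun p => f p + g p := rfl

theorem cls_mul {R : Nat.Primes → Type} [∀ p, CommRing (R p)] (f g : ∀ p, R p) :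
    cls f * cls g = cls fun p => f p * g p := rfl

theorem cls_sub {R : Nat.Primes → Type} [∀ p, CommRing (R p)] (f g : ∀ p, R p) :
    cls f - cls g = cls fun p => f p - g p := rfl

theorem cls_neg {R : Nat.Primes → Type} [∀ p, CommRing (R p)] (f : ∀ p, R p) :
    -cls f = cls fun p => -f p := rfl

theorem cls_one {R : Nat.Primes → Type} [∀ p, CommRing (R p)] :
    (1 : ModSum R) = cls fun _ => 1 := rfl

theorem cls_zero {R : Nat.Primes → Type} [∀ p, CommRing (R p)] :
    (0 : ModSum R) = cls fun _ => 0 := rfl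

theorem cls_list_sum {R : Nat.Primes → Type} [∀ p, CommRing (R p)] {ι : Type*} (L : List ι)
    (f : ι → ∀ p, R p) : (L.map fun i => cls (f i)).sum = cls fun p => (L.map (f · p)).sum := by
  induction L with
  | nil => rfl
  | cons i L ih => rw [List.map_cons, List.sum_cons, ih, cls_add]; rfl

/-- The operator `integ` on `ℬ`. -/
def integB : RingB →ₗ[ℚ] RingB := mapB fun p => integ p

/-- The operator `proj` on `ℬ`. -/
def projB : RingB →ₗ[ℚ] RingB := mapB fun p => proj p

theorem projB_integB (f : RingB) : projB (integB f) = 0 := by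
  obtain ⟨f, rfl⟩ := exists_cls f
  simp only [projB, integB, mapB_cls, proj_integ, ← cls_zero]

theorem integB_one : integB 1 = 0 := by
  simp only [integB, cls_one, mapB_cls, integ_one, cls_zero]

theorem projB_one : projB 1 = 1 := by
  simp only [projB, cls_one, mapB_cls, proj_one]

theorem projB_integB_mul (f h : RingB) : projB (integB f * h) = -projB (f * integB h) := by
  obtain ⟨f, rfl⟩ := exists_cls f
  obtain ⟨h, rfl⟩ := exists_cls h
  simp only [projB, integB, mapB_cls, cls_mul, cls_neg, proj_integ_mul]

theorem integB_mul_integB (f h : RingB) :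
    integB f * integB h = integB (f * integB h) + integB (integB f * h)
      - projB f * integB (integB h) - projB h * integB (integB f)
      + projB (integB f * integB h) := by
  obtain ⟨f, rfl⟩ := exists_cls f
  obtain ⟨h, rfl⟩ := exists_cls h
  simp only [projB, integB, mapB_cls, cls_mul, cls_add, cls_sub, ← integ_mul_integ]

theorem integB_Tp_mul (f : RingB) : integB (Tp * f) = Tp * integB f := by
  obtain ⟨f, rfl⟩ := exists_cls f
  simp only [integB, Tp, mapB_cls, cls_mul, integ_X_pow_mul]

theorem projB_Tp_mul (f : RingB) : projB (Tp * f) = Tp * projB f := by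
  obtain ⟨f, rfl⟩ := exists_cls f
  simp only [projB, Tp, mapB_cls, cls_mul, proj_X_pow_mul]

theorem integB_constants_mul (a : RingA) (f : RingB) :
    integB (constants a * f) = constants a * integB f := by
  obtain ⟨f, rfl⟩ := exists_cls f
  obtain ⟨a, rfl⟩ := exists_cls a
  simp only [integB, integ, mapB_cls, constants_cls, cls_mul, diagonal_C_mul]

theorem projB_constants_mul (a : RingA) (f : RingB) :
    projB (constants a * f) = constants a * projB f := by
  obtain ⟨f, rfl⟩ := exists_cls f
  obtain ⟨a, rfl⟩ := exists_cls a
  simp only [projB, proj, mapB_cls, constants_cls, cls_mul, diagonal_C_mul]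

theorem integB_scalar_mul (a : RingA) (n : ℕ) (f : RingB) :
    integB (constants a * Tp ^ n * f) = constants a * Tp ^ n * integB f := by
  rw [mul_assoc, integB_constants_mul, mul_assoc]
  congr 1
  induction n with
  | zero => simp
  | succ n ih => rw [pow_succ', mul_assoc, integB_Tp_mul, ih, mul_assoc]

theorem projB_scalar_mul (a : RingA) (n : ℕ) (f : RingB) :
    projB (constants a * Tp ^ n * f) = constants a * Tp ^ n * projB f := by
  rw [mul_assoc, projB_constants_mul, mul_assoc]
  congr 1
  induction n with
  | zero => simp
  | succ n ih => rw [pow_succ', mul_assoc, projB_Tp_mul, ih, mul_assoc]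

/-! ### The elements of `ℬ` attached to words -/

/-- The element by which a letter multiplies before `integB` is applied. -/
def letterB (c : Letter) : RingB := cls fun p : Nat.Primes => letterPoly p c

theorem letterB_x : letterB Letter.x = 1 := rfl

theorem projB_letterB_y : projB (letterB Letter.y) = 0 := by
  simp only [projB, letterB, mapB_cls, letterPoly, proj_geom, cls_zero]

/-- The element of `ℬ` attached to a word. -/
def wordB (w : List Letter) : RingB := cls fun p : Nat.Primes => wordPoly p w

theorem wordB_nil : wordB [] = 1 := rfl

theorem wordB_cons (c : Letter) (w : List Letter) :
    wordB (c :: w) = integB (letterB c * wordB w) := rfl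

theorem projB_wordB {w : List Letter} (hw : w ≠ []) : projB (wordB w) = 0 := by
  cases w with
  | nil => exact absurd rfl hw
  | cons c w => rw [wordB_cons, projB_integB]

theorem wordB_append_x (w : List Letter) : wordB (w ++ [Letter.x]) = 0 := by
  induction w with
  | nil => rw [List.nil_append, wordB_cons, letterB_x, wordB_nil, mul_one, integB_one]
  | cons c w ih => rw [List.cons_append, wordB_cons, ih, mul_zero, map_zero]

theorem li_eq_wordB (k : Index) : li k = wordB (indexWord k).toList := by
  simp only [li, liComp_eq_wordPoly]
  rfl

theorem length_blocks (k : List ℕ+) : (blocks k).length = wt k := by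
  induction k with
  | nil => rfl
  | cons a k ih =>
    rw [blocks, List.length_append, List.length_replicate, List.length_cons, ih, wt_cons]
    have := a.pos
    omega

theorem wt_reverse (k : Index) : wt k.reverse = wt k := by
  simp [wt]

theorem length_indexWord (k : Index) : (indexWord k).toList.length = wt k := by
  rw [indexWord, FreeMonoid.toList_ofList, length_blocks, wt_reverse]

theorem exists_blocks_eq (w : List Letter) : ∃ k : List ℕ+, blocks k = w ++ [Letter.y] := by
  induction w with
  | nil => exact ⟨[1], rfl⟩
  | cons c w ih =>
    obtain ⟨k, hk⟩ := ih
    cases c with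
    | y => exact ⟨1 :: k, by rw [blocks, hk]; rfl⟩
    | x =>
      cases k with
      | nil => simp [blocks] at hk
      | cons a k =>
        refine ⟨(a + 1) :: k, ?_⟩
        rw [List.cons_append, ← hk, blocks, blocks, ← List.cons_append, ← List.replicate_succ]
        congr 2
        have := a.pos
        rw [PNat.add_coe, PNat.one_coe]
        omega

/-- A word ending in x starts by integrating 1, which gives 0. Hence arbitrary words can be used
without leaving the span of the li. -/
theorem wordB_eq_zero_or_mem_range (w : List Letter) :
    wordB w = 0 ∨ ∃ k : Index, (indexWord k).toList = w := by
  induction w using List.reverseRecOn with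
  | nil => exact Or.inr ⟨[], rfl⟩
  | append_singleton w c =>
    cases c with
    | x => exact Or.inl (wordB_append_x w)
    | y =>
      obtain ⟨k, hk⟩ := exists_blocks_eq w
      exact Or.inr ⟨k.reverse, by rw [indexWord, List.reverse_reverse, hk]; rfl⟩

/-- The linear extension of `wordB`. -/
def wordLin : H →ₗ[ℚ] RingB :=
  (Finsupp.linearCombination ℚ fun w : FreeMonoid Letter => wordB w.toList) ∘ₗ
    (MonoidAlgebra.coeffLinearEquiv ℚ).toLinearMap

theorem wordLin_apply (f : H) : wordLin f = f.coeff.sum fun w r => r • wordB w.toList := rfl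

theorem wordLin_single (w : FreeMonoid Letter) (r : ℚ) :
    wordLin (MonoidAlgebra.single w r) = r • wordB w.toList := by
  rw [wordLin_apply, MonoidAlgebra.coeff_single]
  exact Finsupp.sum_single_index (zero_smul ℚ (wordB w.toList))

theorem wordLin_word (w : List Letter) : wordLin (word w) = wordB w := by
  rw [word, wordLin_single, one_smul, FreeMonoid.toList_ofList]

theorem wordLin_letter_mul (c : Letter) (f : H) :
    wordLin (word [c] * f) = integB (letterB c * wordLin f) := by
  induction f using MonoidAlgebra.induction_linear with
  | zero => simp only [mul_zero, map_zero]
  | add f g hf hg => simp only [mul_add, map_add, hf, hg]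
  | single w r =>
    rw [word, MonoidAlgebra.single_mul_single, one_mul, wordLin_single, wordLin_single,
      mul_smul_comm, map_smul, ← wordB_cons]
    rfl

theorem shuffle_single (u v : FreeMonoid Letter) :
    shuffle (MonoidAlgebra.single u 1) (MonoidAlgebra.single v 1)
      = shuffleWord u.toList v.toList := by
  simp [shuffle]

/-- `shuffleIndex` discards the words that come from no index; nothing is lost, as their `wordB` is
0. -/
theorem liSum_shuffleIndex (k k' : Index) : liSum (shuffleIndex k k')
    = wordLin (shuffleWord (indexWord k).toList (indexWord k').toList) := by
  rw [liSum, shuffleIndex, ← shuffle_single, wordLin_apply, Finsupp.sum, Finsupp.sum,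
    Finsupp.comapDomain_support]
  simp only [quotient_smul_eq, Finsupp.comapDomain_apply, li_eq_wordB]
  refine Finset.sum_preimage indexWord _ _ (fun w => _ • wordB w.toList) fun w _ hw => ?_
  rcases wordB_eq_zero_or_mem_range w.toList with h | ⟨k, hk⟩
  · rw [h]
    exact (Algebra.smul_def (A := RingB) _ _).trans (mul_zero _)
  · exact absurd ⟨k, FreeMonoid.toList.injective hk⟩ hw

/-! ### Multiple zeta values -/

/-- The finite multiple zeta value of a reversed index, in `ℬ`. -/
def zetaB (k : List ℕ+) : RingB := constants (zetaA k.reverse)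

theorem zetaB_eq_cls (k : List ℕ+) : zetaB k = cls fun p : Nat.Primes => C (harm p k p) := by
  simp only [zetaB, zetaA, zetaComp_eq_harm, List.reverse_reverse, constants_cls]

theorem zetaB_mul (k l : List ℕ+) : zetaB k * zetaB l = ((stuffle k l).map zetaB).sum := by
  have h : ((stuffle k l).map zetaB)
      = (stuffle k l).map fun m => cls fun p : Nat.Primes => C (harm p m p) :=
    List.map_congr_left fun m _ => zetaB_eq_cls m
  rw [h, cls_list_sum, zetaB_eq_cls, zetaB_eq_cls, cls_mul]
  congr 1
  funext p
  rw [← C_mul, harm_mul_harm, map_list_sum, List.map_map]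
  rfl

/-- The truncated polylogarithm in `ℬ`. -/
def truncB (a : ℕ+) (k : List ℕ+) : RingB := cls fun p : Nat.Primes => truncPoly p a k

theorem integB_truncB (a : ℕ+) (k : List ℕ+) : integB (truncB a k) = truncB (a + 1) k := by
  simp only [integB, truncB, mapB_cls, integ_truncPoly]

theorem integB_letterB_y : integB (letterB Letter.y) = truncB 1 [] := by
  simp only [integB, truncB, letterB, letterPoly, mapB_cls, integ_geom]

theorem integB_letterB_y_mul_truncB (b : ℕ+) (k : List ℕ+) :
    integB (letterB Letter.y * truncB b k) = truncB 1 (b :: k)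
      + Tp * (zetaB (b :: k) * truncB 1 [] - truncB (b + 1) k - truncB 1 (b :: k)) := by
  simp only [integB, truncB, letterB, letterPoly, zetaB_eq_cls, Tp, cls_mul, cls_add, cls_sub,
    mapB_cls, integ_geom_mul_truncPoly]

theorem projB_letterB_y_mul_truncB (b : ℕ+) (k : List ℕ+) :
    projB (letterB Letter.y * truncB b k) = Tp * zetaB (b :: k) := by
  simp only [projB, truncB, letterB, letterPoly, zetaB_eq_cls, Tp, cls_mul,
    mapB_cls, proj_geom_mul_truncPoly]

/-! ### The filtration -/

theorem filtR_mono {a : ℕ} {b b' : ℤ} (h : b ≤ b') : filtR a b ≤ filtR a b' := by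
  refine Submodule.span_mono ?_
  rintro f ⟨k, k', n, h1, h2, rfl⟩
  exact ⟨k, k', n, h1, h2.trans h, rfl⟩

theorem scalar_mul_wordB_mem_filtR (k : Index) (n : ℕ) (w : List Letter) {a : ℕ} {b : ℤ}
    (ha : wt k + w.length = a) (hb : (w.length : ℤ) ≤ b) :
    constants (zetaA k) * Tp ^ n * wordB w ∈ filtR a b := by
  rcases wordB_eq_zero_or_mem_range w with h | ⟨l, rfl⟩
  · rw [h, mul_zero]
    exact zero_mem _
  · rw [← li_eq_wordB]
    rw [length_indexWord] at ha hb
    exact Submodule.subset_span ⟨k, l, n, ha, hb, rfl⟩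

theorem zetaB_mul_Tp_pow_mem_filtR (k : List ℕ+) (n : ℕ) : zetaB k * Tp ^ n ∈ filtR (wt k) 0 := by
  have := scalar_mul_wordB_mem_filtR k.reverse n [] (a := wt k) (b := 0)
    (by simp [wt_reverse]) (by simp)
  rwa [wordB_nil, mul_one] at this

/-- Zeta values and powers of T^p commute with `integB`, so the operation only prepends a letter to
the word. -/
theorem integB_letterB_mul_mem_filtR (c : Letter) {a : ℕ} {b : ℤ} {f : RingB}
    (hf : f ∈ filtR a b) : integB (letterB c * f) ∈ filtR (a + 1) (b + 1) := by
  induction hf using Submodule.span_induction with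
  | mem f hf =>
    obtain ⟨k, k', n, h1, h2, rfl⟩ := hf
    rw [mul_left_comm, integB_scalar_mul, li_eq_wordB, ← wordB_cons]
    refine scalar_mul_wordB_mem_filtR k n _ ?_ ?_ <;>
      rw [List.length_cons, length_indexWord]
    · omega
    · push_cast
      omega
  | zero => simp
  | add f g _ _ hf hg =>
    rw [mul_add, map_add]
    exact add_mem hf hg
  | smul r f _ hf =>
    rw [mul_smul_comm, map_smul]
    exact Submodule.smul_mem _ r hf

theorem mul_wordB_mem_filtR (w : List Letter) {a : ℕ} {f : RingB} (hf : f ∈ filtR a 0) :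
    f * wordB w ∈ filtR (a + w.length) w.length := by
  induction hf using Submodule.span_induction with
  | mem f hf =>
    obtain ⟨k, k', n, h1, h2, rfl⟩ := hf
    have hl := length_indexWord k'
    have hk' : (indexWord k').toList = [] := by
      rw [← List.length_eq_zero_iff]
      omega
    rw [li_eq_wordB, hk', wordB_nil, mul_one]
    rw [hk', List.length_nil] at hl
    exact scalar_mul_wordB_mem_filtR k n w (by omega) le_rfl
  | zero => simp
  | add f g _ _ hf hg =>
    rw [add_mul]
    exact add_mem hf hg
  | smul r f _ hf =>
    rw [smul_mul_assoc]
    exact Submodule.smul_mem _ r hf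

/-- The span of the products of zeta values, powers of `T ^ p` and truncated polylogarithms of
total weight `a`. -/
def truncSpan (a : ℕ) : Submodule ℚ RingB :=
  Submodule.span ℚ {f : RingB | ∃ (l : List ℕ+) (n : ℕ) (b : ℕ+) (k : List ℕ+),
    wt l + wt (b :: k) = a ∧ f = zetaB l * Tp ^ n * truncB b k}

theorem mem_truncSpan (l : List ℕ+) (n : ℕ) (b : ℕ+) (k : List ℕ+) {a : ℕ}
    (h : wt l + wt (b :: k) = a) : zetaB l * Tp ^ n * truncB b k ∈ truncSpan a :=
  Submodule.subset_span ⟨l, n, b, k, h, rfl⟩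

theorem zetaB_nil : zetaB [] = 1 := by
  simp only [zetaB_eq_cls, harm, C_1, cls_one]

theorem zetaB_mul_zetaB_mul_mem {U : Submodule ℚ RingB} (k l : List ℕ+) (f : RingB)
    (h : ∀ m, wt m = wt k + wt l → zetaB m * f ∈ U) : zetaB k * zetaB l * f ∈ U := by
  rw [zetaB_mul, ← List.sum_map_mul_right]
  refine list_sum_mem fun g hg => ?_
  obtain ⟨m, hm, rfl⟩ := List.mem_map.mp hg
  exact h m (wt_of_mem_stuffle k l m hm)

theorem integB_letterB_mul_mem_truncSpan (c : Letter) {a : ℕ} {f : RingB}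
    (hf : f ∈ truncSpan a) : integB (letterB c * f) ∈ truncSpan (a + 1) := by
  induction hf using Submodule.span_induction with
  | mem f hf =>
    obtain ⟨l, n, b, k, h, rfl⟩ := hf
    rw [wt_cons] at h
    rw [mul_left_comm]
    conv in zetaB l => rw [zetaB]
    rw [integB_scalar_mul, ← zetaB]
    have h1 : ∀ n, zetaB l * Tp ^ n * truncB (b + 1) k ∈ truncSpan (a + 1) := fun n =>
      mem_truncSpan l n _ _ (by rw [wt_cons, PNat.add_coe, PNat.one_coe]; omega)
    cases c with
    | x =>
      rw [letterB_x, one_mul, integB_truncB]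
      exact h1 n
    | y =>
      have h2 : ∀ n, zetaB l * Tp ^ n * truncB 1 (b :: k) ∈ truncSpan (a + 1) := fun n =>
        mem_truncSpan l n _ _ (by rw [wt_cons, wt_cons, PNat.one_coe]; omega)
      -- The only term with a product of two zeta values; the quasi-shuffle product linearizes it
      -- and preserves the weight.
      have h3 : zetaB l * zetaB (b :: k) * (Tp ^ (n + 1) * truncB 1 []) ∈ truncSpan (a + 1) := by
        refine zetaB_mul_zetaB_mul_mem _ _ _ fun m hm => ?_
        rw [← mul_assoc]
        refine mem_truncSpan m _ _ _ ?_
        rw [hm, wt_cons, wt_cons, PNat.one_coe, ← h]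
        simp only [wt, List.map_nil, List.sum_nil]
        ring
      rw [integB_letterB_y_mul_truncB]
      convert add_mem (h2 n) (sub_mem (sub_mem h3 (h1 (n + 1))) (h2 (n + 1))) using 1
      ring
  | zero => simp
  | add f g _ _ hf hg =>
    rw [mul_add, map_add]
    exact add_mem hf hg
  | smul r f _ hf =>
    rw [mul_smul_comm, map_smul]
    exact Submodule.smul_mem _ r hf

theorem wordB_mem_truncSpan {w : List Letter} (hw : w ≠ []) : wordB w ∈ truncSpan w.length := by
  induction w with
  | nil => exact absurd rfl hw
  | cons c w ih =>
    rcases eq_or_ne w [] with rfl | h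
    · rw [wordB_cons, wordB_nil, mul_one]
      cases c with
      | x =>
        rw [letterB_x, integB_one]
        exact zero_mem _
      | y =>
        have := mem_truncSpan [] 0 1 [] (a := 1) (by simp [wt])
        rw [zetaB_nil, pow_zero, one_mul, one_mul] at this
        rw [integB_letterB_y]
        exact this
    · exact integB_letterB_mul_mem_truncSpan c (ih h)

theorem projB_letterB_y_mul_mem_filtR {a : ℕ} {f : RingB} (hf : f ∈ truncSpan a) :
    projB (letterB Letter.y * f) ∈ filtR a 0 := by
  induction hf using Submodule.span_induction with
  | mem f hf =>
    obtain ⟨l, n, b, k, h, rfl⟩ := hf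
    rw [mul_left_comm]
    conv in zetaB l => rw [zetaB]
    rw [projB_scalar_mul, ← zetaB, projB_letterB_y_mul_truncB]
    have h1 : zetaB l * zetaB (b :: k) * Tp ^ (n + 1) ∈ filtR a 0 :=
      zetaB_mul_zetaB_mul_mem _ _ _ fun m hm => by
        rw [← h, ← hm]
        exact zetaB_mul_Tp_pow_mem_filtR m _
    convert h1 using 1
    ring
  | zero => simp
  | add f g _ _ hf hg =>
    rw [mul_add, map_add]
    exact add_mem hf hg
  | smul r f _ hf =>
    rw [mul_smul_comm, map_smul]
    exact Submodule.smul_mem _ r hf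

theorem projB_letterB_mul_wordB_mem_filtR (c : Letter) (w : List Letter) :
    projB (letterB c * wordB w) ∈ filtR w.length 0 := by
  rcases eq_or_ne w [] with rfl | h
  · cases c with
    | x =>
      rw [letterB_x, wordB_nil, mul_one, projB_one]
      have h := zetaB_mul_Tp_pow_mem_filtR [] 0
      rwa [zetaB_nil, pow_zero, one_mul] at h
    | y =>
      rw [wordB_nil, mul_one, projB_letterB_y]
      exact zero_mem _
  · cases c with
    | x =>
      rw [letterB_x, one_mul, projB_wordB h]
      exact zero_mem _
    | y => exact projB_letterB_y_mul_mem_filtR (wordB_mem_truncSpan h)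

/-- Each integration by parts moves the letter d onto v and frees the first letter of u to take its
place; the total length is unchanged, and u is eventually exhausted. -/
theorem projB_wordB_mul_letterB_mul_wordB_mem_filtR (u : List Letter) (d : Letter)
    (v : List Letter) :
    projB (wordB u * (letterB d * wordB v)) ∈ filtR (u.length + v.length) 0 := by
  induction u generalizing d v with
  | nil =>
    rw [wordB_nil, one_mul, List.length_nil, zero_add]
    exact projB_letterB_mul_wordB_mem_filtR d v
  | cons c u ih =>
    have h := ih c (d :: v)
    rw [wordB_cons c u, projB_integB_mul, ← wordB_cons, mul_comm (letterB c), mul_assoc,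
      List.length_cons, Nat.succ_add_eq_add_succ]
    exact neg_mem h

/-! ### The shuffle relation -/

/-- The words of indices: the empty word and the words ending in `y`. -/
def Admissible (w : List Letter) : Prop := w ≠ [] → w.getLast? = some Letter.y

theorem Admissible.tail {c : Letter} {w : List Letter} (h : Admissible (c :: w)) :
    Admissible w := by
  intro hw
  have := h (List.cons_ne_nil c w)
  rwa [List.getLast?_cons_of_ne_nil hw] at this

theorem admissible_blocks (k : List ℕ+) : Admissible (blocks k) := by
  induction k with
  | nil => exact fun h => absurd rfl h
  | cons a k ih =>
    intro _
    rw [blocks, List.getLast?_append_of_ne_nil _ (List.cons_ne_nil _ _)]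
    rcases eq_or_ne (blocks k) [] with h | h
    · rw [h]
      rfl
    · rw [List.getLast?_cons_of_ne_nil h]
      exact ih h

/-- The projected factor carries weight `u.length`, so there is a drop in the polylogarithm as soon
as u is nonempty. If u is empty, admissibility forces c = y, and the projection vanishes; c = x
would give P(1) = 1 and no drop. -/
theorem projB_mul_integB_mem_filtR {c : Letter} {u : List Letter} (hu : Admissible (c :: u))
    (v : List Letter) : projB (letterB c * wordB u) * integB (wordB v)
      ∈ filtR (u.length + 1 + v.length) (u.length + v.length) := by
  rcases eq_or_ne u [] with rfl | h
  · cases c with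
    | x => simpa using hu (List.cons_ne_nil _ _)
    | y =>
      rw [wordB_nil, mul_one, projB_letterB_y, zero_mul]
      exact zero_mem _
  · have h1 := mul_wordB_mem_filtR (Letter.x :: v) (projB_letterB_mul_wordB_mem_filtR c u)
    rw [wordB_cons Letter.x, letterB_x, one_mul, List.length_cons] at h1
    have h2 := List.length_pos_of_ne_nil h
    rw [show u.length + 1 + v.length = u.length + (v.length + 1) by ring]
    refine filtR_mono ?_ h1
    push_cast
    omega

theorem wordB_mul_wordB_sub_mem_filtR {u v : List Letter} (hu : Admissible u)
    (hv : Admissible v) : wordB u * wordB v - wordLin (shuffleWord u v)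
      ∈ filtR (u.length + v.length) ((u.length : ℤ) + v.length - 1) := by
  induction u, v using shuffleWord.induct with
  | case1 v =>
    rw [shuffleWord, wordLin_word, wordB_nil, one_mul, sub_self]
    exact zero_mem _
  | case2 c u =>
    rw [shuffleWord, wordLin_word, wordB_nil, mul_one, sub_self]
    exact zero_mem _
  | case3 c u d v ih₁ ih₂ =>
    have h₁ := integB_letterB_mul_mem_filtR c (ih₁ hu.tail hv)
    have h₂ := integB_letterB_mul_mem_filtR d (ih₂ hu hv.tail)
    have h₃ := projB_mul_integB_mem_filtR hu (d :: v)
    have h₄ := projB_mul_integB_mem_filtR hv (c :: u)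
    -- The letter x is a dummy: its factor is 1, which leaves the projection of the product of the
    -- two full words.
    have h₅ := projB_wordB_mul_letterB_mul_wordB_mem_filtR (c :: u) Letter.x (d :: v)
    rw [letterB_x, one_mul] at h₅
    rw [shuffleWord, map_add, wordLin_letter_mul, wordLin_letter_mul]
    have key := integB_mul_integB (letterB c * wordB u) (letterB d * wordB v)
    rw [← wordB_cons, ← wordB_cons] at key
    simp only [List.length_cons, mul_sub, map_sub] at h₁ h₂ h₃ h₄ h₅ ⊢
    push_cast at h₁ h₂ h₃ h₄ h₅ ⊢
    have e : (u.length + 1 + (v.length + 1) : ℕ) = u.length + (v.length + 1) + 1 := by ring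
    have e' : (v.length + 1 + (u.length + 1) : ℕ) = u.length + (v.length + 1) + 1 := by ring
    have e'' : (u.length + 1 + v.length + 1 : ℕ) = u.length + (v.length + 1) + 1 := by ring
    rw [e''] at h₂
    rw [e'] at h₄
    rw [e] at h₃ h₅ ⊢
    have m₁ := filtR_mono (b' := (u.length : ℤ) + 1 + (v.length + 1) - 1) (by omega) h₁
    have m₂ := filtR_mono (b' := (u.length : ℤ) + 1 + (v.length + 1) - 1) (by omega) h₂
    have m₃ := filtR_mono (b' := (u.length : ℤ) + 1 + (v.length + 1) - 1) (by omega) h₃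
    have m₄ := filtR_mono (b' := (u.length : ℤ) + 1 + (v.length + 1) - 1) (by omega) h₄
    have m₅ := filtR_mono (b' := (u.length : ℤ) + 1 + (v.length + 1) - 1) (by omega) h₅
    convert add_mem (sub_mem (sub_mem (add_mem m₁ m₂) m₃) m₄) m₅ using 1
    rw [← mul_assoc (letterB c), mul_left_comm (letterB d)]
    linear_combination key

end FiniteMultiplePolylog

end
-- The congruence for indices
theorem mainTheorem1 (k k' : FiniteMultiplePolylog.Index) :
    FiniteMultiplePolylog.li k * FiniteMultiplePolylog.li k' ≡
      FiniteMultiplePolylog.liSum (FiniteMultiplePolylog.shuffleIndex k k')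
      [SMOD FiniteMultiplePolylog.filtR
        (FiniteMultiplePolylog.wt k + FiniteMultiplePolylog.wt k')
        ((FiniteMultiplePolylog.wt k : ℤ) + (FiniteMultiplePolylog.wt k' : ℤ) - 1)] := by
  rw [SModEq.sub_mem, FiniteMultiplePolylog.liSum_shuffleIndex,
    FiniteMultiplePolylog.li_eq_wordB, FiniteMultiplePolylog.li_eq_wordB,
    ← FiniteMultiplePolylog.length_indexWord, ← FiniteMultiplePolylog.length_indexWord]
  exact FiniteMultiplePolylog.wordB_mul_wordB_sub_mem_filtR
    (FiniteMultiplePolylog.admissible_blocks _) (FiniteMultiplePolylog.admissible_blocks _)
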